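/- Let $M_{2^\infty}=\bigotimes_{n\in\mathbb N}M_2(\mathbb C)$ be the CAR algebra and let $\mathbb P(M_{2^\infty})$ be its space of pure states (the extreme points of its state space) with the weak$^*$ topology. For pure states write $\varphi\sim_{M_{2^\infty}}\psi$ if there is a unitary $u\in M_{2^\infty}$ with $\varphi(a)=\psi(uau^*)$ for all $a\in M_{2^\infty}$. For a unit vector $\xi\in\mathbb C^2$ let $\omega_\xi(a)=(a\xi\,|\,\xi)$ be the corresponding vector state of $M_2(\mathbb C)$. Then there is a continuous map $$\Phi\colon\left(-\tfrac{\pi}{2},\tfrac{\pi}{2}\right)^{\mathbb N}\to\mathbb P(M_{2^\infty}),$$ where the domain carries the product topology and whose values are the infinite product states $$\Phi(\vec\alpha)=\bigotimes_{n}\omega_{(\cos(\alpha_n/2),\,\sin(\alpha_n/2))},$$ such that for all $\vec\alpha$ and $\vec\beta$ in the domain $$\sum_n(\alpha_n-\beta_n)^2<\infty\iff\Phi(\vec\alpha)\sim_{M_{2^\infty}}\Phi(\vec\beta).$$ -/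

import Mathlib

open scoped ComplexOrder

noncomputable section

/-! ### States of a unital C⋆-algebra -/

/-- The states of a unital C⋆-algebra `A`: the positive bounded linear functionals with value `1`
at the unit (for a positive functional `φ` one has `‖φ‖ = φ 1`). They are regarded as a subset of
the dual of `A` with its weak-⋆ topology. -/
def stateSet (A : Type*) [CStarAlgebra A] : Set (WeakDual ℂ A) :=
  {φ | (∀ a : A, 0 ≤ φ (star a * a)) ∧ φ 1 = 1}

/-- The pure states of `A`: the extreme points of the convex set of states. As a subtype of the
weak dual it carries the weak-⋆ topology. -/
def pureStates (A : Type*) [CStarAlgebra A] : Set (WeakDual ℂ A) :=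
  Set.extremePoints ℝ (stateSet A)

/-- Equivalence of pure states: `φ = ψ ∘ Ad u` for a unitary `u` of `A`, where
`Ad u a = u a u⋆`. -/
def PureStateEquiv {A : Type*} [CStarAlgebra A] (φ ψ : pureStates A) : Prop :=
  ∃ u ∈ unitary A, ∀ a : A, (φ : WeakDual ℂ A) a = (ψ : WeakDual ℂ A) (u * a * star u)

/-- The vector functional `ω_ξ(a) = (a ξ | ξ)` on the `2 × 2` matrices, the inner product being
linear in its first argument. -/
def vectorState (ξ : Fin 2 → ℂ) (a : Matrix (Fin 2) (Fin 2) ℂ) : ℂ :=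
  ∑ i, (a.mulVec ξ) i * star (ξ i)

/-! ### The CAR algebra -/

/-- Configurations: sequences in `{0, 1}` that are eventually `0`. They label the orthonormal basis
`e_{x 0} ⊗ e_{x 1} ⊗ ⋯` of the infinite tensor product of copies of `ℂ²` along the
unit vectors `e_0`. -/
abbrev CARConfig : Type := ℕ →₀ Fin 2

/-- The infinite tensor product of copies of the Hilbert space `ℂ²` along `e_0`. -/
abbrev CARSpace : Type := lp (fun _ : CARConfig => ℂ) 2

/-- The action of a `2 × 2` matrix on the `n`-th tensor factor, in coordinates. -/
def carActFun (n : ℕ) (M : Matrix (Fin 2) (Fin 2) ℂ) (f : CARConfig → ℂ) : CARConfig → ℂ :=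
  fun x => ∑ b, M (x n) b * f (x.update n b)

/-- Moving the `n`-th entry of a configuration. -/
def carFlip (n : ℕ) : CARConfig ≃ CARConfig := Equiv.addRight (Finsupp.single n 1)

theorem car_sum_update (n : ℕ) (x : CARConfig) (g : Fin 2 → CARConfig → ℂ) :
    ∑ b, g b (x.update n b) = g (x n) x + g (x n + 1) (carFlip n x) := by
  have h1 : x.update n (x n) = x := by simp
  have h2 : x.update n (x n + 1) = carFlip n x := by
    ext m
    by_cases h : m = n
    · subst h; simp [carFlip]
    · simp [carFlip, Finsupp.update_apply, h]
  rw [Fin.sum_univ_two, ← h2]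
  conv_rhs => rw [← congrArg (g (x n)) h1]
  generalize x n = c
  fin_cases c
  · simp
  · simp [add_comm]

theorem carFlip_carFlip (n : ℕ) (x : CARConfig) : carFlip n (carFlip n x) = x := by
  have h : ∀ c : Fin 2, c + 1 + 1 = c := by decide
  ext m
  by_cases hm : m = n
  · subst hm; simp [carFlip, h]
  · simp [carFlip, Ne.symm hm]

theorem carFlip_apply_self (n : ℕ) (x : CARConfig) : carFlip n x n = x n + 1 := by
  simp [carFlip]

theorem carActFun_apply (n : ℕ) (M : Matrix (Fin 2) (Fin 2) ℂ) (f : CARConfig → ℂ)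
    (x : CARConfig) :
    carActFun n M f x = M (x n) (x n) * f x + M (x n) (x n + 1) * f (carFlip n x) :=
  car_sum_update n x fun b y => M (x n) b * f y

/-- The sum of the moduli of the entries, a bound for the operator norm. -/
def carBound (M : Matrix (Fin 2) (Fin 2) ℂ) : ℝ := ∑ i, ∑ j, ‖M i j‖

theorem norm_entry_le_carBound (M : Matrix (Fin 2) (Fin 2) ℂ) (i j : Fin 2) :
    ‖M i j‖ ≤ carBound M :=
  (Finset.single_le_sum (f := fun j => ‖M i j‖) (fun _ _ => norm_nonneg _)
    (Finset.mem_univ j)).trans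
    (Finset.single_le_sum (f := fun i => ∑ j, ‖M i j‖)
      (fun _ _ => Finset.sum_nonneg fun _ _ => norm_nonneg _) (Finset.mem_univ i))

theorem carActFun_sq_le (n : ℕ) (M : Matrix (Fin 2) (Fin 2) ℂ) (f : CARConfig → ℂ)
    (x : CARConfig) :
    ‖carActFun n M f x‖ ^ 2 ≤
      2 * carBound M ^ 2 * (‖f x‖ ^ 2 + ‖f (carFlip n x)‖ ^ 2) := by
  have h0 : 0 ≤ carBound M :=
    (norm_nonneg (M 0 0)).trans (norm_entry_le_carBound M 0 0)
  have h : ‖carActFun n M f x‖ ≤ carBound M * (‖f x‖ + ‖f (carFlip n x)‖) := by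
    rw [carActFun_apply, mul_add]
    refine (norm_add_le _ _).trans ?_
    rw [norm_mul, norm_mul]
    gcongr <;> exact norm_entry_le_carBound _ _ _
  calc ‖carActFun n M f x‖ ^ 2
      ≤ (carBound M * (‖f x‖ + ‖f (carFlip n x)‖)) ^ 2 := by gcongr
    _ = carBound M ^ 2 * (‖f x‖ + ‖f (carFlip n x)‖) ^ 2 := by ring
    _ ≤ carBound M ^ 2 * (2 * (‖f x‖ ^ 2 + ‖f (carFlip n x)‖ ^ 2)) := by
        gcongr
        nlinarith [sq_nonneg (‖f x‖ - ‖f (carFlip n x)‖)]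
    _ = _ := by ring

theorem car_summable_sq (f : CARSpace) : Summable fun x => ‖f x‖ ^ 2 := by
  have := (lp.memℓp f).summable (by norm_num)
  simpa using this

theorem car_norm_sq (f : CARSpace) : ‖f‖ ^ 2 = ∑' x, ‖f x‖ ^ 2 := by
  have := lp.norm_rpow_eq_tsum (p := 2) (by norm_num) f
  simpa using this

theorem car_summable_flip_sq (n : ℕ) (f : CARSpace) :
    Summable fun x => ‖f (carFlip n x)‖ ^ 2 :=
  (carFlip n).summable_iff.mpr (car_summable_sq f)

theorem carActFun_mem (n : ℕ) (M : Matrix (Fin 2) (Fin 2) ℂ) (f : CARSpace) :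
    Memℓp (E := fun _ : CARConfig => ℂ) (carActFun n M f) 2 := by
  apply memℓp_gen
  have : Summable fun x => ‖carActFun n M f x‖ ^ 2 :=
    Summable.of_nonneg_of_le (fun _ => sq_nonneg _) (carActFun_sq_le n M f)
      (((car_summable_sq f).add (car_summable_flip_sq n f)).mul_left _)
  simpa using this

/-- The action of a matrix on the `n`-th tensor factor, as a bounded operator. -/
def carAct (n : ℕ) (M : Matrix (Fin 2) (Fin 2) ℂ) : CARSpace →L[ℂ] CARSpace :=
  LinearMap.mkContinuous
    { toFun := fun f => ⟨carActFun n M f, carActFun_mem n M f⟩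
      map_add' := fun f g => by
        ext x
        change carActFun n M (⇑f + ⇑g) x = carActFun n M f x + carActFun n M g x
        simp only [carActFun_apply, Pi.add_apply]
        ring
      map_smul' := fun c f => by
        ext x
        change carActFun n M (c • ⇑f) x = c * carActFun n M f x
        simp only [carActFun_apply, Pi.smul_apply, smul_eq_mul]
        ring }
    (2 * carBound M) fun f => by
      have h0 : 0 ≤ carBound M :=
        (norm_nonneg (M 0 0)).trans (norm_entry_le_carBound M 0 0)
      have hs := (car_summable_sq f).add (car_summable_flip_sq n f)
      have hflip : ∑' x, ‖f (carFlip n x)‖ ^ 2 = ∑' x, ‖f x‖ ^ 2 :=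
        (carFlip n).tsum_eq fun x => ‖f x‖ ^ 2
      refine le_of_sq_le_sq ?_ (by positivity)
      rw [car_norm_sq, mul_pow, car_norm_sq f]
      calc ∑' x, ‖carActFun n M f x‖ ^ 2
          ≤ ∑' x, 2 * carBound M ^ 2 * (‖f x‖ ^ 2 + ‖f (carFlip n x)‖ ^ 2) :=
            Summable.tsum_le_tsum (carActFun_sq_le n M f)
              (Summable.of_nonneg_of_le (fun _ => sq_nonneg _) (carActFun_sq_le n M f)
                (hs.mul_left _)) (hs.mul_left _)
        _ = (2 * carBound M) ^ 2 * ∑' x, ‖f x‖ ^ 2 := by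
            rw [tsum_mul_left, (car_summable_sq f).tsum_add (car_summable_flip_sq n f), hflip]
            ring

theorem carAct_apply (n : ℕ) (M : Matrix (Fin 2) (Fin 2) ℂ) (f : CARSpace) (x : CARConfig) :
    carAct n M f x = ∑ b, M (x n) b * f (x.update n b) := rfl

theorem carAct_apply' (n : ℕ) (M : Matrix (Fin 2) (Fin 2) ℂ) (f : CARSpace) (x : CARConfig) :
    carAct n M f x = M (x n) (x n) * f x + M (x n) (x n + 1) * f (carFlip n x) :=
  carActFun_apply n M f x

theorem carAct_one (n : ℕ) : carAct n 1 = 1 := by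
  ext f x
  simp [carAct_apply, Matrix.one_apply]

theorem carAct_mul (n : ℕ) (M N : Matrix (Fin 2) (Fin 2) ℂ) :
    carAct n (M * N) = carAct n M * carAct n N := by
  ext f x
  change carAct n (M * N) f x = carAct n M (carAct n N f) x
  simp only [carAct_apply, Matrix.mul_apply, Fin.sum_univ_two]
  simp [Finsupp.update_idem]
  ring

theorem carAct_add (n : ℕ) (M N : Matrix (Fin 2) (Fin 2) ℂ) :
    carAct n (M + N) = carAct n M + carAct n N := by
  ext f x
  change carAct n (M + N) f x = carAct n M f x + carAct n N f x
  simp only [carAct_apply', Matrix.add_apply]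
  ring

theorem carAct_smul (n : ℕ) (c : ℂ) (M : Matrix (Fin 2) (Fin 2) ℂ) :
    carAct n (c • M) = c • carAct n M := by
  ext f x
  change carAct n (c • M) f x = c * carAct n M f x
  simp only [carAct_apply', Matrix.smul_apply, smul_eq_mul]
  ring

theorem car_summable_mul (f g c : CARConfig → ℂ) (C : ℝ) (hc : ∀ x, ‖c x‖ ≤ C)
    (hf : Summable fun x => ‖f x‖ ^ 2) (hg : Summable fun x => ‖g x‖ ^ 2) :
    Summable fun x => c x * g x * star (f x) := by
  refine Summable.of_norm_bounded ((hf.add hg).mul_left C) fun x => ?_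
  rw [norm_mul, norm_mul, norm_star, mul_assoc]
  have hC : 0 ≤ C := (norm_nonneg _).trans (hc x)
  refine mul_le_mul (hc x) ?_ (by positivity) hC
  nlinarith [sq_nonneg (‖f x‖ - ‖g x‖), sq_nonneg (‖f x‖), sq_nonneg (‖g x‖)]

theorem carAct_star (n : ℕ) (M : Matrix (Fin 2) (Fin 2) ℂ) :
    carAct n (star M) = star (carAct n M) := by
  rw [ContinuousLinearMap.star_eq_adjoint, ContinuousLinearMap.eq_adjoint_iff]
  intro f g
  have hc : ∀ c : Fin 2, c + 1 + 1 = c := by decide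
  have hM := norm_entry_le_carBound M
  have s1 : Summable fun x => M (x n) (x n) * g x * star (f x) :=
    car_summable_mul f g _ _ (fun x => hM _ _) (car_summable_sq f) (car_summable_sq g)
  have s2 : Summable fun x => M (x n + 1) (x n) * g x * star (f (carFlip n x)) :=
    car_summable_mul (fun x => f (carFlip n x)) g _ _ (fun x => hM _ _)
      (car_summable_flip_sq n f) (car_summable_sq g)
  have s3 : Summable fun x => M (x n) (x n + 1) * g (carFlip n x) * star (f x) :=
    car_summable_mul f (fun x => g (carFlip n x)) _ _ (fun x => hM _ _)
      (car_summable_sq f) (car_summable_flip_sq n g)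
  rw [lp.inner_eq_tsum, lp.inner_eq_tsum]
  calc ∑' x, inner ℂ (carAct n (star M) f x) (g x)
      = ∑' x, (M (x n) (x n) * g x * star (f x) +
          M (x n + 1) (x n) * g x * star (f (carFlip n x))) := by
        refine tsum_congr fun x => ?_
        rw [carAct_apply', RCLike.inner_apply]
        simp only [Matrix.star_apply, map_add, map_mul, starRingEnd_apply, star_star]
        ring
    _ = (∑' x, M (x n) (x n) * g x * star (f x)) +
          ∑' x, M (x n + 1) (x n) * g x * star (f (carFlip n x)) := s1.tsum_add s2
    _ = (∑' x, M (x n) (x n) * g x * star (f x)) +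
          ∑' x, M (x n) (x n + 1) * g (carFlip n x) * star (f x) := by
        congr 1
        rw [← (carFlip n).tsum_eq fun x => M (x n + 1) (x n) * g x * star (f (carFlip n x))]
        refine tsum_congr fun x => ?_
        rw [carFlip_carFlip, carFlip_apply_self, hc]
    _ = ∑' x, (M (x n) (x n) * g x * star (f x) +
          M (x n) (x n + 1) * g (carFlip n x) * star (f x)) := (s1.tsum_add s3).symm
    _ = ∑' x, inner ℂ (f x) (carAct n M g x) := by
        refine tsum_congr fun x => ?_
        rw [carAct_apply', RCLike.inner_apply, starRingEnd_apply]
        ring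

/-- The `n`-th copy of the `2 × 2` matrices, as a unital ⋆-homomorphism. -/
def carHom (n : ℕ) : Matrix (Fin 2) (Fin 2) ℂ →⋆ₐ[ℂ] (CARSpace →L[ℂ] CARSpace) where
  toFun := carAct n
  map_one' := carAct_one n
  map_mul' := carAct_mul n
  map_zero' := by simpa using carAct_smul n 0 0
  map_add' := carAct_add n
  commutes' c := by
    rw [Algebra.algebraMap_eq_smul_one, carAct_smul, carAct_one, Algebra.algebraMap_eq_smul_one]
  map_star' := carAct_star n

/-- Different copies of the matrix algebra commute. -/
theorem carHom_commute {m n : ℕ} (h : m ≠ n) (M N : Matrix (Fin 2) (Fin 2) ℂ) :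
    Commute (carHom m M) (carHom n N) := by
  ext f x
  change carAct m M (carAct n N f) x = carAct n N (carAct m M f) x
  simp only [carAct_apply, Fin.sum_univ_two]
  simp [Finsupp.update_apply, h, h.symm, Finsupp.update_comm _ h]
  ring

/-- The CAR algebra `M_{2^∞} = ⨂ M₂(ℂ)`, realised as the C⋆-algebra of operators that is generated
by the commuting copies of the `2 × 2` matrices acting on the separate tensor factors, that is, the
norm closure of the increasing union of the `2ⁿ × 2ⁿ` matrix algebras acting on the first `n`
factors. -/
def carSubalgebra : StarSubalgebra ℂ (CARSpace →L[ℂ] CARSpace) :=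
  (StarAlgebra.adjoin ℂ (⋃ n, Set.range (carHom n))).topologicalClosure

/-- The CAR algebra as a type. -/
abbrev CARAlgebra : Type := carSubalgebra

instance carAlgebraCStar : CStarAlgebra CARAlgebra :=
  StarSubalgebra.cstarAlgebra carSubalgebra
    (h_closed := StarSubalgebra.isClosed_topologicalClosure _)

/-- The embedding of the `n`-th tensor factor in the CAR algebra. -/
def carFactor (n : ℕ) : Matrix (Fin 2) (Fin 2) ℂ →⋆ₐ[ℂ] CARAlgebra :=
  StarAlgHom.codRestrict (carHom n) carSubalgebra fun M =>
    StarSubalgebra.le_topologicalClosure _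
      (StarAlgebra.subset_adjoin ℂ _ (Set.mem_iUnion.mpr ⟨n, M, rfl⟩))

/-- `φ` is the infinite product state `⨂ₙ ω_{ξ n}` of the CAR algebra: for all `n` and all matrices
`a 0, …, a (n - 1)` it sends `a 0 ⊗ ⋯ ⊗ a (n - 1)` to the product of the `ω_{ξ i} (a i)`.
Such elements span a dense subspace, so this determines `φ`. -/
def IsProductState (φ : WeakDual ℂ CARAlgebra) (ξ : ℕ → Fin 2 → ℂ) : Prop :=
  ∀ (n : ℕ) (a : ℕ → Matrix (Fin 2) (Fin 2) ℂ),
    φ ((List.range n).map fun i => carFactor i (a i)).prod =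
      ∏ i ∈ Finset.range n, vectorState (ξ i) (a i)

end

/-!
The argument works in any C⋆-algebra that contains a sequence of commuting copies `f i` of the
`2 × 2` matrices generating a dense ⋆-subalgebra, and uses of the concrete CAR algebra only this
and the vector state at `e_0 ⊗ e_0 ⊗ ⋯`.

The product state with angles `θ` is handled through the condition that it has value `1` at the
projection `angleProj (θ i)` of each factor. By Cauchy–Schwarz a state with this property is
unchanged when its argument is multiplied by such a projection, so its values on elementary tensors
are forced (`apply_tensorProd`, `eq_of_apply_angleProj`). Purity is immediate, because the
condition passes to both states of a convex decomposition. Existence and weak-⋆ continuity follow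
from compactness of the state space (`exists_mem_stateSet_apply_angleProj`,
`continuous_of_apply_angleProj`).

If two product states are conjugate by a unitary `u`, then `u` is close to an element of finitely
many factors, hence nearly commutes with all the later ones, and there the two states nearly agree.
Evaluating them at the projections onto the first product vector keeps the tail products of
`cos² ((α i - β i) / 2)` above `1 / 2`, so `∑ sin² ((α i - β i) / 2)` converges
(`summable_sq_of_unitary_conj`). Since `|α i - β i| < π`, so does `∑ (α i - β i) ^ 2`.

Conversely, rotating factor by factor gives an infinite product that converges in norm only if
`∑ |α i - β i|` does. Instead the factors are grouped into blocks over which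
`∑ (α i - β i) ^ 2` decays geometrically. In each block the projections `p`, `q` onto the two
product vectors satisfy `p q p = c² p` with `c = ∏ cos ((α i - β i) / 2)`, and the rotation in
the plane of these vectors is a unitary at distance `O(√(1 - c²))` from `1`
(`exists_unitary_rotation`). These distances are summable, so the product of the block rotations
converges to a unitary that conjugates one state to the other
(`exists_unitary_conj_of_summable_sq`).
-/

noncomputable section


/-! ### States: Cauchy–Schwarz, compactness, compression -/

section States

variable {A : Type*} [CStarAlgebra A]

/-- Cauchy–Schwarz for a state, from the semi-inner product of its GNS construction. -/
theorem norm_sq_apply_star_mul_le {φ : WeakDual ℂ A} (hφ : φ ∈ stateSet A) (a b : A) :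
    ‖φ (star a * b)‖ ^ 2 ≤ (φ (star a * a)).re * (φ (star b * b)).re := by
  let _ := CStarAlgebra.spectralOrder A
  let _ := CStarAlgebra.spectralOrderedRing A
  let F : A →ₚ[ℂ] ℂ := PositiveLinearMap.mk₀ (φ : A →ₗ[ℂ] ℂ) fun x hx => by
    obtain ⟨b, rfl⟩ := CStarAlgebra.nonneg_iff_eq_star_mul_self.mp hx
    exact hφ.1 b
  have h := norm_inner_le_norm (𝕜 := ℂ) (F.toPreGNS a) (F.toPreGNS b)
  have hsq : ∀ x : A, ‖F.toPreGNS x‖ ^ 2 = (φ (star x * x)).re := fun x => by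
    rw [F.preGNS_norm_def, Real.sq_sqrt]
    · rfl
    · exact (Complex.nonneg_iff.mp (hφ.1 x)).1
  calc ‖φ (star a * b)‖ ^ 2 ≤ (‖F.toPreGNS a‖ * ‖F.toPreGNS b‖) ^ 2 := by
        gcongr
        exact h
    _ = _ := by rw [mul_pow, hsq, hsq]

theorem norm_apply_le_of_mem_stateSet {φ : WeakDual ℂ A} (hφ : φ ∈ stateSet A) (a : A) :
    ‖φ a‖ ≤ ‖a‖ := by
  let _ := CStarAlgebra.spectralOrder A
  let _ := CStarAlgebra.spectralOrderedRing A
  have h1 := norm_sq_apply_star_mul_le hφ 1 a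
  have h2 : (φ (star a * a)).re ≤ ‖a‖ ^ 2 := by
    obtain ⟨b, hb⟩ := CStarAlgebra.nonneg_iff_eq_star_mul_self.mp
      (sub_nonneg.mpr (CStarAlgebra.star_mul_le_algebraMap_norm_sq (a := a)))
    have h3 := hφ.1 b
    have h4 : algebraMap ℝ A (‖a‖ ^ 2) = ((‖a‖ ^ 2 : ℝ) : ℂ) • (1 : A) := by
      rw [Algebra.algebraMap_eq_smul_one, Complex.coe_smul]
    rw [← hb, map_sub, h4, map_smul, hφ.2] at h3
    have := (Complex.nonneg_iff.mp h3).1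
    rw [Complex.sub_re, smul_eq_mul, mul_one, Complex.ofReal_re] at this
    linarith
  simp only [star_one, one_mul, hφ.2, Complex.one_re] at h1
  exact le_of_sq_le_sq (h1.trans h2) (norm_nonneg a)

/-- A state with value `1` at a projection `e` does not see the complement of `e`. -/
theorem apply_mul_proj {φ : WeakDual ℂ A} (hφ : φ ∈ stateSet A) {e : A}
    (he : IsStarProjection e) (h1 : φ e = 1) (a : A) : φ (a * e) = φ a := by
  have hc := he.one_sub
  have h0 : φ (star (1 - e) * (1 - e)) = 0 := by
    rw [hc.isSelfAdjoint.star_eq, hc.isIdempotentElem.eq, map_sub, hφ.2, h1, sub_self]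
  have h := norm_sq_apply_star_mul_le hφ (star a) (1 - e)
  rw [h0, Complex.zero_re, mul_zero, star_star, mul_sub, mul_one, map_sub] at h
  have := pow_eq_zero_iff (two_ne_zero) |>.mp (le_antisymm h (sq_nonneg _))
  exact (sub_eq_zero.mp (norm_eq_zero.mp this)).symm

theorem apply_proj_mul {φ : WeakDual ℂ A} (hφ : φ ∈ stateSet A) {e : A}
    (he : IsStarProjection e) (h1 : φ e = 1) (a : A) : φ (e * a) = φ a := by
  have hc := he.one_sub
  have h0 : φ (star (1 - e) * (1 - e)) = 0 := by
    rw [hc.isSelfAdjoint.star_eq, hc.isIdempotentElem.eq, map_sub, hφ.2, h1, sub_self]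
  have h := norm_sq_apply_star_mul_le hφ (1 - e) a
  rw [h0, Complex.zero_re, zero_mul, hc.isSelfAdjoint.star_eq, sub_mul, one_mul, map_sub] at h
  have := pow_eq_zero_iff (two_ne_zero) |>.mp (le_antisymm h (sq_nonneg _))
  exact (sub_eq_zero.mp (norm_eq_zero.mp this)).symm

theorem apply_proj_nonneg {φ : WeakDual ℂ A} (hφ : φ ∈ stateSet A) {e : A}
    (he : IsStarProjection e) : 0 ≤ (φ e).re ∧ (φ e).im = 0 := by
  have h := hφ.1 e
  rw [he.isSelfAdjoint.star_eq, he.isIdempotentElem.eq] at h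
  exact ⟨(Complex.nonneg_iff.mp h).1, (Complex.nonneg_iff.mp h).2.symm⟩

theorem apply_proj_re_le_one {φ : WeakDual ℂ A} (hφ : φ ∈ stateSet A) {e : A}
    (he : IsStarProjection e) : (φ e).re ≤ 1 := by
  have h := (apply_proj_nonneg hφ he.one_sub).1
  rw [map_sub, hφ.2, Complex.sub_re, Complex.one_re] at h
  linarith

/-- If a state has value `1` at a projection `p` with `p = p * e`, it has value `1` at `e`. -/
theorem apply_eq_one_of_mul_eq {φ : WeakDual ℂ A} (hφ : φ ∈ stateSet A) {p e : A}
    (hp : IsStarProjection p) (h1 : φ p = 1) (h : p * e = p) : φ e = 1 := by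
  rw [← apply_proj_mul hφ hp h1, h, h1]

theorem isCompact_stateSet : IsCompact (stateSet A) := by
  have hcl : IsClosed (stateSet A) := by
    have : stateSet A = (⋂ a : A, {φ : WeakDual ℂ A | 0 ≤ φ (star a * a)}) ∩
        {φ : WeakDual ℂ A | φ 1 = 1} := by
      ext φ
      simp [stateSet]
    rw [this]
    exact (isClosed_iInter fun a => isClosed_le continuous_const (WeakDual.eval_continuous _)).inter
      (isClosed_eq (WeakDual.eval_continuous _) continuous_const)
  refine (WeakDual.isCompact_closedBall (0 : StrongDual ℂ A) 1).of_isClosed_subset hcl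
    fun φ hφ => ?_
  rw [Set.mem_preimage, mem_closedBall_zero_iff]
  refine ContinuousLinearMap.opNorm_le_bound _ zero_le_one fun a => ?_
  rw [one_mul]
  exact norm_apply_le_of_mem_stateSet hφ a

/-- The functional `a ↦ φ (y⋆ a y)`. -/
def compress (φ : WeakDual ℂ A) (y : A) : WeakDual ℂ A :=
  StrongDual.toWeakDual
    ((WeakDual.toStrongDual φ).comp (ContinuousLinearMap.mulLeftRight ℂ A (star y) y))

@[simp]
theorem compress_apply (φ : WeakDual ℂ A) (y a : A) : compress φ y a = φ (star y * a * y) := by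
  simp [compress]

theorem compress_mem_stateSet {φ : WeakDual ℂ A} (hφ : φ ∈ stateSet A) {y : A}
    (hy : φ (star y * y) = 1) : compress φ y ∈ stateSet A := by
  refine ⟨fun a => ?_, by simpa using hy⟩
  have := hφ.1 (a * y)
  rw [star_mul] at this
  simpa [mul_assoc] using this

end States


/-! ### Rank-one projections in the `2 × 2` matrices -/

/-- The unit vector at angle `θ / 2`. -/
def angleVector (θ : ℝ) : Fin 2 → ℂ := ![(Real.cos (θ / 2) : ℂ), (Real.sin (θ / 2) : ℂ)]

/-- The orthogonal projection onto the line through `angleVector θ`. -/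
def angleProj (θ : ℝ) : Matrix (Fin 2) (Fin 2) ℂ :=
  Matrix.vecMulVec (angleVector θ) (angleVector θ)

theorem angle_sq_add_sq (θ : ℝ) :
    (Real.cos (θ / 2) : ℂ) * Real.cos (θ / 2) + (Real.sin (θ / 2) : ℂ) * Real.sin (θ / 2) = 1 := by
  norm_cast
  nlinarith [Real.sin_sq_add_cos_sq (θ / 2)]

theorem angleProj_mul_mul (θ : ℝ) (M : Matrix (Fin 2) (Fin 2) ℂ) :
    angleProj θ * M * angleProj θ = vectorState (angleVector θ) M • angleProj θ := by
  ext i j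
  simp only [angleProj, angleVector, vectorState, Matrix.mul_apply, Matrix.vecMulVec_apply,
    Matrix.smul_apply, Matrix.mulVec, dotProduct, Fin.sum_univ_two, Matrix.cons_val_zero,
    Matrix.cons_val_one, smul_eq_mul, Complex.star_def, Complex.conj_ofReal]
  ring

theorem vectorState_one (θ : ℝ) : vectorState (angleVector θ) 1 = 1 := by
  rw [← angle_sq_add_sq θ]
  simp only [vectorState, angleVector, Matrix.one_mulVec, Fin.sum_univ_two, Matrix.cons_val_zero,
    Matrix.cons_val_one, Complex.star_def, Complex.conj_ofReal]

theorem vectorState_angleProj (θ τ : ℝ) :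
    vectorState (angleVector θ) (angleProj τ) = ((Real.cos ((θ - τ) / 2) ^ 2 : ℝ) : ℂ) := by
  rw [sub_div, Real.cos_sub]
  simp only [angleProj, angleVector, vectorState, Matrix.vecMulVec_apply,
    Matrix.mulVec, dotProduct, Fin.sum_univ_two, Matrix.cons_val_zero,
    Matrix.cons_val_one, Complex.star_def, Complex.conj_ofReal]
  push_cast
  ring

theorem isStarProjection_angleProj (θ : ℝ) : IsStarProjection (angleProj θ) where
  isIdempotentElem := by
    have := angleProj_mul_mul θ 1
    rwa [mul_one, vectorState_one, one_smul] at this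
  isSelfAdjoint := by
    ext i j
    simp only [angleProj, angleVector, Matrix.star_apply, Matrix.vecMulVec_apply]
    fin_cases i <;> fin_cases j <;>
      simp [mul_comm, -Complex.ofReal_cos, -Complex.ofReal_sin, Complex.conj_ofReal]

/-! ### Products over commuting copies of the `2 × 2` matrices -/

section Factors

variable {A : Type*} [CStarAlgebra A]

/-- The element `a 0 ⊗ ⋯ ⊗ a (n - 1)` of an algebra that contains copies `f i` of the `2 × 2`
matrices. -/
def tensorProd (f : ℕ → Matrix (Fin 2) (Fin 2) ℂ →⋆ₐ[ℂ] A)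
    (a : ℕ → Matrix (Fin 2) (Fin 2) ℂ) (n : ℕ) : A :=
  ((List.range n).map fun i => f i (a i)).prod

variable {f : ℕ → Matrix (Fin 2) (Fin 2) ℂ →⋆ₐ[ℂ] A}

@[simp]
theorem tensorProd_zero (a : ℕ → Matrix (Fin 2) (Fin 2) ℂ) : tensorProd f a 0 = 1 := rfl

theorem tensorProd_succ (a : ℕ → Matrix (Fin 2) (Fin 2) ℂ) (n : ℕ) :
    tensorProd f a (n + 1) = tensorProd f a n * f n (a n) :=
  List.prod_range_succ _ _

theorem commute_tensorProd {x : A} {a : ℕ → Matrix (Fin 2) (Fin 2) ℂ} {n : ℕ}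
    (h : ∀ i < n, Commute x (f i (a i))) : Commute x (tensorProd f a n) := by
  induction n with
  | zero => exact Commute.one_right x
  | succ n ih =>
    rw [tensorProd_succ]
    exact (ih fun i hi => h i (by omega)).mul_right (h n (by omega))

variable (hf : ∀ i j, i ≠ j → ∀ M N, Commute (f i M) (f j N))
include hf

theorem tensorProd_mul (a b : ℕ → Matrix (Fin 2) (Fin 2) ℂ) (n : ℕ) :
    tensorProd f a n * tensorProd f b n = tensorProd f (fun i => a i * b i) n := by
  induction n with
  | zero => simp
  | succ n ih =>
    have hc : Commute (f n (a n)) (tensorProd f b n) :=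
      commute_tensorProd fun i hi => hf n i (by omega) _ _
    rw [tensorProd_succ, tensorProd_succ, tensorProd_succ, ← ih, map_mul]
    rw [mul_assoc, ← mul_assoc (f n (a n)), hc.eq]
    simp only [mul_assoc]

theorem star_tensorProd (a : ℕ → Matrix (Fin 2) (Fin 2) ℂ) (n : ℕ) :
    star (tensorProd f a n) = tensorProd f (fun i => star (a i)) n := by
  induction n with
  | zero => simp
  | succ n ih =>
    have hc : Commute (f n (star (a n))) (tensorProd f (fun i => star (a i)) n) :=
      commute_tensorProd fun i hi => hf n i (by omega) _ _
    rw [tensorProd_succ, tensorProd_succ, star_mul, ih, ← map_star, hc.eq]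

omit hf in
/-- Padding with units: a product of `n` factors is a product of `n + k` factors. -/
theorem tensorProd_eq_add (a : ℕ → Matrix (Fin 2) (Fin 2) ℂ) (n k : ℕ) :
    tensorProd f a n = tensorProd f (fun i => if i < n then a i else 1) (n + k) := by
  induction k with
  | zero =>
    refine congrArg List.prod (List.map_congr_left fun i hi => ?_)
    simp [List.mem_range.mp hi]
  | succ k ih => rw [← add_assoc, tensorProd_succ, ← ih]; simp

omit hf in
theorem tensorProd_single (n : ℕ) (M : Matrix (Fin 2) (Fin 2) ℂ) :
    f n M = tensorProd f (fun i => if i = n then M else 1) (n + 1) := by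
  have h : ∀ k ≤ n, tensorProd f (fun i => if i = n then M else 1) k = 1 := by
    intro k hk
    induction k with
    | zero => rfl
    | succ k ih =>
      rw [tensorProd_succ, ih (by omega), if_neg (by omega), map_one, mul_one]
  rw [tensorProd_succ, h n le_rfl, if_pos rfl, one_mul]

/-- The elementary tensors span the ⋆-algebra generated by the factors. -/
theorem adjoin_subset_span_tensorProd {x : A}
    (hx : x ∈ StarAlgebra.adjoin ℂ (⋃ n, Set.range (f n))) :
    x ∈ Submodule.span ℂ (Set.range fun p : (ℕ → Matrix (Fin 2) (Fin 2) ℂ) × ℕ =>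
      tensorProd f p.1 p.2) := by
  induction hx using StarAlgebra.adjoin_induction with
  | mem x hx =>
    obtain ⟨n, M, rfl⟩ := Set.mem_iUnion.mp hx
    exact Submodule.subset_span ⟨(_, _), (tensorProd_single n M).symm⟩
  | algebraMap r =>
    rw [Algebra.algebraMap_eq_smul_one]
    exact Submodule.smul_mem _ _ (Submodule.subset_span ⟨(fun _ => 1, 0), rfl⟩)
  | add x y _ _ hx hy => exact Submodule.add_mem _ hx hy
  | mul x y hx' hy' hx hy =>
    clear hx' hy'
    induction hx, hy using Submodule.span_induction₂ with
    | mem_mem x y hx hy =>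
      obtain ⟨⟨a, n⟩, rfl⟩ := hx
      obtain ⟨⟨b, m⟩, rfl⟩ := hy
      simp only
      rw [tensorProd_eq_add a n m, tensorProd_eq_add b m n, add_comm m n,
        tensorProd_mul hf]
      exact Submodule.subset_span ⟨(_, _), rfl⟩
    | zero_left y => simp
    | zero_right x => simp
    | add_left x y z _ _ _ h1 h2 => rw [add_mul]; exact Submodule.add_mem _ h1 h2
    | add_right x y z _ _ _ h1 h2 => rw [mul_add]; exact Submodule.add_mem _ h1 h2
    | smul_left r x y _ _ h => rw [smul_mul_assoc]; exact Submodule.smul_mem _ _ h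
    | smul_right r x y _ _ h => rw [mul_smul_comm]; exact Submodule.smul_mem _ _ h
  | star x hx' hx =>
    clear hx'
    induction hx using Submodule.span_induction with
    | mem x hx =>
      obtain ⟨⟨a, n⟩, rfl⟩ := hx
      exact Submodule.subset_span ⟨(_, n), (star_tensorProd hf a n).symm⟩
    | zero => simp
    | add x y _ _ h1 h2 => rw [star_add]; exact Submodule.add_mem _ h1 h2
    | smul r x _ h => rw [star_smul]; exact Submodule.smul_mem _ _ h

/-- Two functionals that agree on the elementary tensors are equal if these generate. -/
theorem weakDual_ext_tensorProd
    (hd : Dense (StarAlgebra.adjoin ℂ (⋃ n, Set.range (f n)) : Set A)) {φ ψ : WeakDual ℂ A}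
    (h : ∀ a n, φ (tensorProd f a n) = ψ (tensorProd f a n)) : φ = ψ := by
  refine DFunLike.coe_injective (Continuous.ext_on hd (map_continuous φ) (map_continuous ψ)
    fun x hx => ?_)
  replace hx := adjoin_subset_span_tensorProd hf hx
  induction hx using Submodule.span_induction with
  | mem x hx => obtain ⟨⟨a, n⟩, rfl⟩ := hx; exact h a n
  | zero => simp
  | add x y _ _ h1 h2 => rw [map_add, map_add, h1, h2]
  | smul r x _ h => rw [map_smul, map_smul, h]

/-! ### Product states -/

omit hf in
theorem isStarProjection_factor (n : ℕ) (θ : ℝ) : IsStarProjection (f n (angleProj θ)) :=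
  (isStarProjection_angleProj θ).map (f n)

/-- A state that has value `1` at the projections of the angles `θ i` in the factors is a product
state on the elementary tensors: the projection of the last factor may be placed on both sides of
its entry, which then becomes a scalar. -/
theorem apply_tensorProd {φ : WeakDual ℂ A} (hφ : φ ∈ stateSet A) {θ : ℕ → ℝ}
    (h1 : ∀ i, φ (f i (angleProj (θ i))) = 1) (a : ℕ → Matrix (Fin 2) (Fin 2) ℂ) (n : ℕ) :
    φ (tensorProd f a n) = ∏ i ∈ Finset.range n, vectorState (angleVector (θ i)) (a i) := by
  induction n with
  | zero => simpa using hφ.2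
  | succ n ih =>
    have hp := isStarProjection_factor (f := f) n (θ n)
    have hc : Commute (f n (angleProj (θ n))) (tensorProd f a n) :=
      commute_tensorProd fun i hi => hf n i (by omega) _ _
    have hmul : f n (angleProj (θ n)) * (tensorProd f a n * f n (a n)) * f n (angleProj (θ n)) =
        vectorState (angleVector (θ n)) (a n) • (tensorProd f a n * f n (angleProj (θ n))) := by
      rw [← mul_assoc, hc.eq, mul_assoc, mul_assoc, ← mul_assoc (f n _), ← map_mul, ← map_mul,
        angleProj_mul_mul, map_smul, mul_smul_comm]
    rw [Finset.prod_range_succ, tensorProd_succ, ← ih, ← apply_proj_mul hφ hp (h1 n),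
      ← apply_mul_proj hφ hp (h1 n), hmul, map_smul, apply_mul_proj hφ hp (h1 n), smul_eq_mul,
      mul_comm]

theorem eq_of_apply_angleProj
    (hd : Dense (StarAlgebra.adjoin ℂ (⋃ n, Set.range (f n)) : Set A)) {φ ψ : WeakDual ℂ A}
    (hφ : φ ∈ stateSet A) (hψ : ψ ∈ stateSet A) {θ : ℕ → ℝ}
    (h1 : ∀ i, φ (f i (angleProj (θ i))) = 1) (h2 : ∀ i, ψ (f i (angleProj (θ i))) = 1) :
    φ = ψ :=
  weakDual_ext_tensorProd hf hd fun a n => by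
    rw [apply_tensorProd hf hφ h1, apply_tensorProd hf hψ h2]

/-- A state with value `1` at all the projections is pure: both states of a convex decomposition
have value `1` there too. -/
theorem mem_pureStates_of_apply_angleProj
    (hd : Dense (StarAlgebra.adjoin ℂ (⋃ n, Set.range (f n)) : Set A)) {φ : WeakDual ℂ A}
    (hφ : φ ∈ stateSet A) {θ : ℕ → ℝ} (h1 : ∀ i, φ (f i (angleProj (θ i))) = 1) :
    φ ∈ pureStates A := by
  refine ⟨hφ, fun ψ hψ χ hχ hseg => ?_⟩
  refine eq_of_apply_angleProj hf hd hψ hφ (θ := θ) (fun i => ?_) h1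
  obtain ⟨s, t, hs, ht, hst, rfl⟩ := hseg
  have hp := isStarProjection_factor (f := f) i (θ i)
  have h := congrArg Complex.re (h1 i)
  have h' : ((s • ψ + t • χ : WeakDual ℂ A) (f i (angleProj (θ i)))).re =
      s * (ψ (f i (angleProj (θ i)))).re + t * (χ (f i (angleProj (θ i)))).re := by
    change ((s : ℝ) • ψ (f i (angleProj (θ i))) + (t : ℝ) • χ (f i (angleProj (θ i)))).re = _
    simp
  rw [h', Complex.one_re] at h
  refine Complex.ext ?_ (by simpa using (apply_proj_nonneg hψ hp).2)
  rw [Complex.one_re]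
  nlinarith [apply_proj_re_le_one hψ hp, apply_proj_re_le_one hχ hp]

theorem isStarProjection_tensorProd (θ : ℕ → ℝ) (n : ℕ) :
    IsStarProjection (tensorProd f (fun i => angleProj (θ i)) n) where
  isIdempotentElem := by
    rw [IsIdempotentElem, tensorProd_mul hf]
    simp only [(isStarProjection_angleProj _).isIdempotentElem.eq]
  isSelfAdjoint := by
    rw [IsSelfAdjoint, star_tensorProd hf]
    simp only [(isStarProjection_angleProj _).isSelfAdjoint.star_eq]

theorem tensorProd_angleProj_mul (θ : ℕ → ℝ) {i n : ℕ} (hi : i < n) :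
    tensorProd f (fun i => angleProj (θ i)) n * f i (angleProj (θ i)) =
      tensorProd f (fun i => angleProj (θ i)) n := by
  induction n with
  | zero => omega
  | succ n ih =>
    rw [tensorProd_succ]
    rcases Nat.lt_succ_iff_lt_or_eq.mp hi with h | rfl
    · rw [mul_assoc, (hf n i (by omega) _ _).eq, ← mul_assoc, ih h]
    · rw [mul_assoc, (isStarProjection_factor i (θ i)).isIdempotentElem.eq]

/-- For projections `q`, `p` onto product vectors, `p * q * p` is the multiple of `p` by the
squared modulus of their inner product. -/
theorem tensorProd_angleProj_mul_mul (θ τ : ℕ → ℝ) (n : ℕ) :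
    tensorProd f (fun i => angleProj (θ i)) n * tensorProd f (fun i => angleProj (τ i)) n *
        tensorProd f (fun i => angleProj (θ i)) n =
      (((∏ i ∈ Finset.range n, Real.cos ((θ i - τ i) / 2)) ^ 2 : ℝ) : ℂ) •
        tensorProd f (fun i => angleProj (θ i)) n := by
  rw [tensorProd_mul hf, tensorProd_mul hf]
  induction n with
  | zero => simp
  | succ n ih =>
    rw [tensorProd_succ, ih, tensorProd_succ, angleProj_mul_mul, vectorState_angleProj, map_smul,
      Finset.prod_range_succ, mul_pow, Complex.ofReal_mul, smul_mul_assoc, mul_smul_comm, smul_smul]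

/-- The product state with angles `θ` as a limit of compressions of the product state with
angles `0` by the projections onto the first factors of the product vector. -/
theorem exists_mem_stateSet_apply_angleProj {φ : WeakDual ℂ A} (hφ : φ ∈ stateSet A)
    (h0 : ∀ i, φ (f i (angleProj 0)) = 1) {θ : ℕ → ℝ} (hθ : ∀ i, Real.cos (θ i / 2) ≠ 0) :
    ∃ ψ ∈ stateSet A, ∀ i, ψ (f i (angleProj (θ i))) = 1 := by
  let S : ℕ → Set (WeakDual ℂ A) := fun n =>
    {ψ | ψ ∈ stateSet A ∧ ∀ i < n, ψ (f i (angleProj (θ i))) = 1}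
  have hcl : ∀ n, IsClosed (S n) := fun n => by
    have : S n = stateSet A ∩ ⋂ i, ⋂ (_ : i < n),
        {ψ : WeakDual ℂ A | ψ (f i (angleProj (θ i))) = 1} := by
      ext ψ; simp [S]
    rw [this]
    exact isCompact_stateSet.isClosed.inter (isClosed_iInter fun i => isClosed_iInter fun _ =>
      isClosed_eq (WeakDual.eval_continuous _) continuous_const)
  have hne : ∀ n, (S n).Nonempty := fun n => by
    set Q := tensorProd f (fun i => angleProj (θ i)) n with hQ
    have hQp : IsStarProjection Q := isStarProjection_tensorProd hf θ n
    set r : ℝ := ∏ i ∈ Finset.range n, Real.cos (θ i / 2) with hr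
    have hr0 : (r : ℂ) ≠ 0 := by
      exact_mod_cast Finset.prod_ne_zero_iff.mpr fun i _ => hθ i
    have hφQ : φ Q = (r : ℂ) ^ 2 := by
      rw [hQ, apply_tensorProd hf hφ (θ := fun _ => 0) h0]
      simp only [vectorState_angleProj, zero_sub, neg_div, Real.cos_neg]
      rw [hr, Complex.ofReal_prod, ← Finset.prod_pow]
      push_cast
      rfl
    have hs : star ((r : ℂ)⁻¹ • Q) = (r : ℂ)⁻¹ • Q := by
      rw [star_smul, hQp.isSelfAdjoint.star_eq, Complex.star_def, map_inv₀, Complex.conj_ofReal]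
    have hy : φ (star ((r : ℂ)⁻¹ • Q) * ((r : ℂ)⁻¹ • Q)) = 1 := by
      rw [hs, smul_mul_smul, hQp.isIdempotentElem.eq, map_smul, hφQ, smul_eq_mul]
      field_simp
    refine ⟨compress φ ((r : ℂ)⁻¹ • Q), compress_mem_stateSet hφ hy, fun i hi => ?_⟩
    rw [compress_apply, ← hy, hs, smul_mul_assoc, tensorProd_angleProj_mul hf θ hi]
  have hcomp : IsCompact (S 0) :=
    isCompact_stateSet.of_isClosed_subset (hcl 0) fun ψ h => h.1
  obtain ⟨ψ, hψ⟩ := IsCompact.nonempty_iInter_of_sequence_nonempty_isCompact_isClosed S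
    (fun n ψ h => ⟨h.1, fun i hi => h.2 i (by omega)⟩) hne hcomp hcl
  rw [Set.mem_iInter] at hψ
  exact ⟨ψ, (hψ 0).1, fun i => (hψ (i + 1)).2 i (by omega)⟩

/-- A state of which the angles are recorded by its values at the projections depends
continuously on the angles: the state space is compact, and every cluster point of `Φ` at `x` has
value `1` at the projections for `x`, hence equals `Φ x`. -/
theorem continuous_of_apply_angleProj
    (hd : Dense (StarAlgebra.adjoin ℂ (⋃ n, Set.range (f n)) : Set A))
    {X : Type*} [TopologicalSpace X] {θ : X → ℕ → ℝ} (hθ : ∀ i, Continuous fun x => θ x i)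
    {Φ : X → WeakDual ℂ A} (hΦ : ∀ x, Φ x ∈ stateSet A)
    (h1 : ∀ x i, Φ x (f i (angleProj (θ x i))) = 1) : Continuous Φ := by
  rw [continuous_iff_continuousAt]
  intro x
  refine isCompact_stateSet.tendsto_nhds_of_unique_mapClusterPt (Filter.Eventually.of_forall hΦ)
    fun ψ hψ hcl => eq_of_apply_angleProj hf hd hψ (hΦ x) (fun i => ?_) (h1 x)
  -- By boundedness of states, `Φ y` is close to `1` at the projection of the angle `θ x i`.
  have hproj : Continuous fun y => f i (angleProj (θ y i)) := by
    have hm : Continuous fun y => angleProj (θ y i) := by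
      refine continuous_matrix fun j k => ?_
      have hv : ∀ l, Continuous fun y => angleVector (θ y i) l := by
        intro l
        have := hθ i
        fin_cases l
        · change Continuous fun y => (Real.cos (θ y i / 2) : ℂ)
          fun_prop
        · change Continuous fun y => (Real.sin (θ y i / 2) : ℂ)
          fun_prop
      exact (hv j).mul (hv k)
    exact ((f i : Matrix (Fin 2) (Fin 2) ℂ →ₗ[ℂ] A).continuous_of_finiteDimensional).comp hm
  have hlim : Filter.Tendsto (fun y => Φ y (f i (angleProj (θ x i)))) (nhds x) (nhds 1) := by
    rw [tendsto_iff_norm_sub_tendsto_zero]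
    refine squeeze_zero (g := fun y => ‖f i (angleProj (θ x i)) - f i (angleProj (θ y i))‖)
      (fun _ => norm_nonneg _) (fun y => ?_) ?_
    · rw [← h1 y i, ← map_sub]
      exact norm_apply_le_of_mem_stateSet (hΦ y) _
    · have : Continuous fun y => ‖f i (angleProj (θ x i)) - f i (angleProj (θ y i))‖ :=
        (continuous_const.sub hproj).norm
      simpa using this.tendsto x
  have hcl' : MapClusterPt (ψ (f i (angleProj (θ x i)))) (nhds x)
      fun y => Φ y (f i (angleProj (θ x i))) :=
    hcl.tendsto_comp (WeakDual.eval_continuous (f i (angleProj (θ x i)))).continuousAt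
  exact eq_of_nhds_neBot (hcl'.clusterPt.neBot.mono (inf_le_inf_left _ hlim))

end Factors


/-! ### Equivalent product states have square-summable angle differences -/

section Factors

variable {A : Type*} [CStarAlgebra A]

variable {f : ℕ → Matrix (Fin 2) (Fin 2) ℂ →⋆ₐ[ℂ] A}

/-- An element of the ⋆-algebra generated by the factors involves finitely many of them. -/
theorem exists_commute_of_mem_adjoin (hf : ∀ i j, i ≠ j → ∀ M N, Commute (f i M) (f j N)) {v : A}
    (hv : v ∈ StarAlgebra.adjoin ℂ (⋃ n, Set.range (f n))) :
    ∃ m, ∀ j, m ≤ j → ∀ M, Commute v (f j M) := by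
  induction hv using StarAlgebra.adjoin_induction with
  | mem x hx =>
    obtain ⟨n, M, rfl⟩ := Set.mem_iUnion.mp hx
    exact ⟨n + 1, fun j hj N => hf n j (by omega) M N⟩
  | algebraMap r => exact ⟨0, fun j _ M => Algebra.commutes r _⟩
  | add x y _ _ hx hy =>
    obtain ⟨m, hm⟩ := hx
    obtain ⟨n, hn⟩ := hy
    exact ⟨max m n, fun j hj M => (hm j (le_of_max_le_left hj) M).add_left
      (hn j (le_of_max_le_right hj) M)⟩
  | mul x y _ _ hx hy =>
    obtain ⟨m, hm⟩ := hx
    obtain ⟨n, hn⟩ := hy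
    exact ⟨max m n, fun j hj M => (hm j (le_of_max_le_left hj) M).mul_left
      (hn j (le_of_max_le_right hj) M)⟩
  | star x _ hx =>
    obtain ⟨m, hm⟩ := hx
    refine ⟨m, fun j hj M => ?_⟩
    have := (hm j hj (star M)).star_star
    rwa [← map_star, star_star] at this

/-- If the partial products of `cos² x i` stay above `1 / 2`, then `∑ sin² x i` converges. -/
theorem summable_sin_sq_of_half_le_prod {x : ℕ → ℝ}
    (h : ∀ n, 1 / 2 ≤ ∏ i ∈ Finset.range n, Real.cos (x i) ^ 2) :
    Summable fun i => Real.sin (x i) ^ 2 := by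
  refine summable_of_sum_range_le (c := 1) (fun _ => sq_nonneg _) fun n => ?_
  set S := ∑ i ∈ Finset.range n, Real.sin (x i) ^ 2
  have h1 : ∏ i ∈ Finset.range n, Real.cos (x i) ^ 2 ≤ Real.exp (-S) := by
    rw [← Finset.sum_neg_distrib, Real.exp_sum]
    refine Finset.prod_le_prod (fun _ _ => sq_nonneg _) fun i _ => ?_
    have := Real.add_one_le_exp (-Real.sin (x i) ^ 2)
    linarith [Real.sin_sq_add_cos_sq (x i)]
  have h2 : Real.exp (-S) * Real.exp S = 1 := by rw [← Real.exp_add]; simp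
  have h3 := Real.add_one_le_exp S
  nlinarith [h n, Real.exp_pos S]

/-- Jordan's inequality in squared form. -/
theorem sq_le_pi_sq_mul_sin_sq {x : ℝ} (hx : |x| < Real.pi) :
    x ^ 2 ≤ Real.pi ^ 2 * Real.sin (x / 2) ^ 2 := by
  have h := Real.mul_le_sin (x := |x| / 2) (by positivity) (by linarith)
  have h' : |x| ≤ Real.pi * Real.sin (|x| / 2) := by
    calc |x| = Real.pi * (2 / Real.pi * (|x| / 2)) := by field_simp
      _ ≤ _ := by gcongr
  have hs : Real.sin (|x| / 2) ^ 2 = Real.sin (x / 2) ^ 2 := by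
    rcases abs_choice x with h | h <;> rw [h]
    rw [neg_div, Real.sin_neg, neg_sq]
  rw [← sq_abs, ← hs, ← mul_pow]
  gcongr

/-- The implementing unitary nearly commutes with far-out factors, so there the two states nearly
agree; they are compared on the projections onto the first product vector. -/
theorem summable_sq_of_unitary_conj (hf : ∀ i j, i ≠ j → ∀ M N, Commute (f i M) (f j N))
    (hd : Dense (StarAlgebra.adjoin ℂ (⋃ n, Set.range (f n)) : Set A)) {φ ψ : WeakDual ℂ A}
    (hφ : φ ∈ stateSet A) (hψ : ψ ∈ stateSet A) {α β : ℕ → ℝ}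
    (h1 : ∀ i, φ (f i (angleProj (α i))) = 1) (h2 : ∀ i, ψ (f i (angleProj (β i))) = 1)
    (hlt : ∀ i, |α i - β i| < Real.pi) {u : A} (hu : u ∈ unitary A)
    (h : ∀ a, φ a = ψ (u * a * star u)) : Summable fun i => (α i - β i) ^ 2 := by
  obtain ⟨v, hv, hlt_v⟩ := Metric.dense_iff.mp hd u (1 / 4) (by norm_num)
  rw [SetLike.mem_coe] at hlt_v
  rw [Metric.mem_ball, dist_comm, dist_eq_norm] at hv
  obtain ⟨m, hm⟩ := exists_commute_of_mem_adjoin hf hlt_v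
  let g : ℕ → Matrix (Fin 2) (Fin 2) ℂ →⋆ₐ[ℂ] A := fun i => f (m + i)
  have hg : ∀ i j, i ≠ j → ∀ M N, Commute (g i M) (g j N) := fun i j hij =>
    hf _ _ (by omega)
  have key : ∀ n, 1 / 2 ≤ ∏ i ∈ Finset.range n, Real.cos ((β (m + i) - α (m + i)) / 2) ^ 2 := by
    intro n
    set a := tensorProd g (fun i => angleProj (α (m + i))) n with ha
    have ha1 : ‖a‖ ≤ 1 :=
      (isStarProjection_tensorProd hg (fun i => α (m + i)) n).norm_le
    have hav : Commute v a := commute_tensorProd fun i _ => hm (m + i) (by omega) _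
    have hφa : φ a = 1 := by
      rw [ha, apply_tensorProd hg hφ (θ := fun i => α (m + i)) fun i => h1 (m + i)]
      simp [vectorState_angleProj]
    have hψa : ψ a =
        ((∏ i ∈ Finset.range n, Real.cos ((β (m + i) - α (m + i)) / 2) ^ 2 : ℝ) : ℂ) := by
      rw [ha, apply_tensorProd hg hψ (θ := fun i => β (m + i)) fun i => h2 (m + i)]
      simp only [vectorState_angleProj]
      rw [Complex.ofReal_prod]
    have hua : ‖u * a * star u - a‖ ≤ 1 / 2 := by
      have e : u * a * star u - a = ((u - v) * a - a * (u - v)) * star u := by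
        have h3 : a * u * star u = a := by
          rw [mul_assoc, Unitary.mul_star_self_of_mem hu, mul_one]
        calc u * a * star u - a = (u * a - a * u) * star u := by rw [sub_mul, h3]
          _ = _ := by
            congr 1
            rw [sub_mul, mul_sub, hav.eq]
            abel
      rw [e, CStarRing.norm_mul_mem_unitary _ (Unitary.star_mem hu)]
      calc _ ≤ ‖u - v‖ * ‖a‖ + ‖a‖ * ‖u - v‖ :=
            (norm_sub_le _ _).trans (add_le_add (norm_mul_le _ _) (norm_mul_le _ _))
        _ ≤ 1 / 2 := by nlinarith [norm_nonneg (u - v), norm_nonneg a]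
    have hdiff : ‖(1 : ℂ) - ψ a‖ ≤ 1 / 2 := by
      rw [← hφa, h a, ← map_sub]
      exact (norm_apply_le_of_mem_stateSet hψ _).trans hua
    have hre := (Complex.re_le_norm _).trans hdiff
    rw [hψa, Complex.sub_re, Complex.one_re, Complex.ofReal_re] at hre
    linarith
  have hs := summable_sin_sq_of_half_le_prod key
  rw [← summable_nat_add_iff m]
  refine Summable.of_nonneg_of_le (fun _ => sq_nonneg _) (fun i => ?_) (hs.mul_left (Real.pi ^ 2))
  rw [add_comm i m, ← neg_sq, neg_sub]
  refine sq_le_pi_sq_mul_sin_sq ?_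
  rw [abs_sub_comm]
  exact hlt _

end Factors


/-! ### Rotating one projection to another -/

section Rotation

variable {A : Type*} [CStarAlgebra A]

/-- If `p q p = c² p` and `q p q = c² q` with `c > 0`, then the reflections in `p` and in the
projection `m` that bisects the angle between `p` and `q` compose to a unitary that rotates `p` to
`q`. It is close to `1` when `c` is close to `1`. -/
theorem exists_unitary_rotation {p q : A} (hp : IsStarProjection p) (hq : IsStarProjection q)
    {c : ℝ} (hc0 : 0 < c) (hc1 : c ≤ 1) (hpqp : p * q * p = ((c ^ 2 : ℝ) : ℂ) • p)
    (hqpq : q * p * q = ((c ^ 2 : ℝ) : ℂ) • q) :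
    ∃ w ∈ unitary A, w * p = q * w ∧
      (∀ x, Commute x p → Commute x q → Commute x w) ∧
      (1 / 2 ≤ c → ‖w - 1‖ ≤ 18 * √(1 - c ^ 2)) := by
  have hpp : p * p = p := hp.isIdempotentElem.eq
  have hqq : q * q = q := hq.isIdempotentElem.eq
  have hps : star p = p := hp.isSelfAdjoint.star_eq
  have hqs : star q = q := hq.isSelfAdjoint.star_eq
  have hC : (c : ℂ) ≠ 0 := by exact_mod_cast hc0.ne'
  have hC1 : (1 + c : ℂ) ≠ 0 := by exact_mod_cast (by positivity : (1 + c) ≠ 0)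
  push_cast at hpqp hqpq
  rw [mul_assoc] at hpqp hqpq
  set m : A := (2 * (1 + c) : ℂ)⁻¹ • (p + q + (c : ℂ)⁻¹ • (p * q + q * p)) with hm
  have hms : star m = m := by
    have e1 : star ((2 * (1 + c) : ℂ)⁻¹) = (2 * (1 + c) : ℂ)⁻¹ := by
      simp [Complex.conj_ofReal]
    have e2 : star ((c : ℂ)⁻¹) = (c : ℂ)⁻¹ := by
      simp [Complex.conj_ofReal]
    rw [hm, star_smul, star_add, star_add, star_smul, star_add, star_mul, star_mul, hps, hqs, e1,
      e2, add_comm (q * p)]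
  have hmp : m * p = (1 / 2 : ℂ) • p + ((c : ℂ)⁻¹ / 2) • (q * p) := by
    simp only [hm, smul_mul_assoc, add_mul, mul_assoc, hpp, hpqp]
    (match_scalars <;> field_simp); ring
  have hmq : m * q = (1 / 2 : ℂ) • q + ((c : ℂ)⁻¹ / 2) • (p * q) := by
    simp only [hm, smul_mul_assoc, add_mul, mul_assoc, hqq, hqpq]
    (match_scalars <;> field_simp); ring
  have hqm : q * m = (1 / 2 : ℂ) • q + ((c : ℂ)⁻¹ / 2) • (q * p) := by
    simp only [hm, mul_smul_comm, mul_add, ← mul_assoc, hqq]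
    rw [mul_assoc q p q, hqpq]
    (match_scalars <;> field_simp); ring
  have hmm : m * m = m := by
    have : m * m = (2 * (1 + c) : ℂ)⁻¹ • (m * p + m * q + (c : ℂ)⁻¹ • (m * p * q + m * q * p)) := by
      conv_lhs => rw [hm, mul_smul_comm, ← hm]
      simp only [mul_add, mul_smul_comm, mul_assoc]
    rw [this, hmp, hmq]
    simp only [smul_mul_assoc, add_mul, mul_assoc, hpqp, hqpq]
    rw [hm]
    match_scalars <;> field_simp <;> ring
  -- The reflections in `m` and `p`.
  have hrefl : ∀ e : A, e * e = e → (e + e - 1) * (e + e - 1) = 1 := fun e he => by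
    simp only [mul_sub, sub_mul, mul_add, add_mul, he, mul_one, one_mul]
    abel
  have hs : star (m + m - 1) = m + m - 1 := by simp [hms]
  have hs' : star (p + p - 1) = p + p - 1 := by simp [hps]
  refine ⟨(m + m - 1) * (p + p - 1), ?_, ?_, ?_, ?_⟩
  · rw [Unitary.mem_iff, star_mul, hs, hs']
    constructor
    · rw [mul_assoc, ← mul_assoc (m + m - 1), hrefl m hmm, one_mul, hrefl p hpp]
    · rw [mul_assoc, ← mul_assoc (p + p - 1), hrefl p hpp, one_mul, hrefl m hmm]
  · have h1 : (p + p - 1) * p = p * (p + p - 1) := by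
      simp only [mul_sub, sub_mul, mul_add, add_mul, mul_one, one_mul]
    have h2 : (m + m - 1) * p = q * (m + m - 1) := by
      simp only [mul_sub, sub_mul, mul_add, add_mul, mul_one, one_mul, hmp, hqm]
      module
    rw [mul_assoc, h1, ← mul_assoc, h2, mul_assoc]
  · intro x hxp hxq
    have hxm : Commute x m :=
      ((hxp.add_right hxq).add_right
        (((hxp.mul_right hxq).add_right (hxq.mul_right hxp)).smul_right _)).smul_right _
    exact ((hxm.add_right hxm).sub_right (Commute.one_right x)).mul_right
      ((hxp.add_right hxp).sub_right (Commute.one_right x))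
  · intro hc2
    set s := √(1 - c ^ 2) with hs_def
    have hs0 : 0 ≤ s := Real.sqrt_nonneg _
    have hss : s ^ 2 = 1 - c ^ 2 := Real.sq_sqrt (by nlinarith)
    have hp1 : ‖p‖ ≤ 1 := hp.norm_le
    set x := q - p with hx
    -- `x ^ 4 = (1 - c ^ 2) x ^ 2`, which determines the norm of the self-adjoint element `x`.
    have hxs : IsSelfAdjoint x := hq.isSelfAdjoint.sub hp.isSelfAdjoint
    have hx4 : (x * x) * (x * x) = ((s ^ 2 : ℝ) : ℂ) • (x * x) := by
      have hx3 : x * (x * x) = ((s ^ 2 : ℝ) : ℂ) • x := by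
        rw [hss, hx]
        have hppq : p * (p * q) = p * q := by rw [← mul_assoc, hpp]
        have hqqp : q * (q * p) = q * p := by rw [← mul_assoc, hqq]
        simp only [mul_sub, sub_mul, hpp, hqq, hppq, hqqp, hpqp, hqpq]
        push_cast
        module
      rw [mul_assoc, hx3, mul_smul_comm]
    have hxn : ‖x‖ ≤ s := by
      have h1 : ‖x * x‖ = ‖x‖ ^ 2 := hxs.norm_mul_self
      have hxxs : IsSelfAdjoint (x * x) := by
        simpa [hxs.star_eq] using IsSelfAdjoint.star_mul_self x
      have h2 : ‖(x * x) * (x * x)‖ = ‖x * x‖ ^ 2 := hxxs.norm_mul_self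
      rw [hx4, norm_smul, Complex.norm_real, Real.norm_of_nonneg (sq_nonneg s), h1] at h2
      by_contra! hlt
      have hx0 : 0 < ‖x‖ := hs0.trans_lt hlt
      have : s ^ 2 = ‖x‖ ^ 2 := mul_right_cancel₀ (pow_pos hx0 2).ne' (by rw [h2]; ring)
      nlinarith
    have hmp' : m - p = (2 * (1 + c) : ℂ)⁻¹ •
        (x + (c : ℂ)⁻¹ • (p * x + x * p) + ((2 * s ^ 2 / c : ℝ) : ℂ) • p) := by
      rw [hss, hm, hx]
      simp only [mul_sub, sub_mul, hpp]
      push_cast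
      (match_scalars <;> field_simp); ring
    have hs1 : s ≤ 1 := by nlinarith
    have hcinv : c⁻¹ ≤ 2 := by
      rw [inv_le_comm₀ hc0 two_pos]; linarith
    have hmpn : ‖m - p‖ ≤ 3 * s := by
      have hA : ‖(2 * (1 + c) : ℂ)⁻¹‖ ≤ 1 / 3 := by
        rw [norm_inv]
        have : ‖(2 * (1 + c) : ℂ)‖ = 2 * (1 + c) := by
          have : (2 * (1 + c) : ℂ) = ((2 * (1 + c) : ℝ) : ℂ) := by push_cast; ring
          rw [this, Complex.norm_real, Real.norm_of_nonneg (by positivity)]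
        rw [this, one_div]
        exact inv_anti₀ (by norm_num) (by linarith)
      have hB : ‖(c : ℂ)⁻¹ • (p * x + x * p)‖ ≤ 4 * s := by
        rw [norm_smul, norm_inv, Complex.norm_real, Real.norm_of_nonneg hc0.le]
        have : ‖p * x + x * p‖ ≤ 2 * s := by
          calc _ ≤ ‖p‖ * ‖x‖ + ‖x‖ * ‖p‖ :=
                (norm_add_le _ _).trans (add_le_add (norm_mul_le _ _) (norm_mul_le _ _))
            _ ≤ 2 * s := by nlinarith [norm_nonneg x, norm_nonneg p]
        calc _ ≤ 2 * (2 * s) := by gcongr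
          _ = _ := by ring
      have hD : ‖((2 * s ^ 2 / c : ℝ) : ℂ) • p‖ ≤ 4 * s := by
        rw [norm_smul, Complex.norm_real, Real.norm_of_nonneg (by positivity)]
        calc 2 * s ^ 2 / c * ‖p‖ ≤ 2 * s ^ 2 * 2 * 1 := by
              rw [div_eq_mul_inv]; gcongr
          _ ≤ 4 * s := by nlinarith
      rw [hmp', norm_smul]
      calc _ ≤ 1 / 3 * (s + 4 * s + 4 * s) := by
            gcongr
            exact (norm_add_le _ _).trans (add_le_add ((norm_add_le _ _).trans
              (add_le_add hxn hB)) hD)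
        _ = _ := by ring
    have hw : (m + m - 1) * (p + p - 1) - 1 =
        (4 : ℂ) • ((m - p) * p) - (2 : ℂ) • (m - p) := by
      simp only [mul_sub, sub_mul, mul_add, add_mul, mul_one, one_mul, hpp]
      module
    rw [hw]
    calc _ ≤ 4 * (‖m - p‖ * ‖p‖) + 2 * ‖m - p‖ := by
          refine (norm_sub_le _ _).trans (add_le_add ?_ ?_)
          · rw [norm_smul]
            simpa using norm_mul_le (m - p) p
          · rw [norm_smul]
            simp
      _ ≤ 18 * s := by nlinarith [norm_nonneg (m - p), norm_nonneg p]

/-- A sequence of commuting pairs of projections at angles that are small in the long run is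
rotated by a single unitary, an infinite product of commuting rotations. -/
theorem exists_unitary_rotation_seq {p q : ℕ → A} (hp : ∀ k, IsStarProjection (p k))
    (hq : ∀ k, IsStarProjection (q k)) {c : ℕ → ℝ} (hc0 : ∀ k, 0 < c k) (hc1 : ∀ k, c k ≤ 1)
    (hpqp : ∀ k, p k * q k * p k = ((c k ^ 2 : ℝ) : ℂ) • p k)
    (hqpq : ∀ k, q k * p k * q k = ((c k ^ 2 : ℝ) : ℂ) • q k)
    (hpp : ∀ j k, j ≠ k → Commute (p j) (p k)) (hqq : ∀ j k, j ≠ k → Commute (q j) (q k))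
    (hpq : ∀ j k, j ≠ k → Commute (p j) (q k)) (hsum : Summable fun k => √(1 - c k ^ 2)) :
    ∃ u ∈ unitary A, ∀ k, u * p k = q k * u := by
  choose w hw hwp hwc hwn using fun k =>
    exists_unitary_rotation (hp k) (hq k) (hc0 k) (hc1 k) (hpqp k) (hqpq k)
  let U : ℕ → A := fun n => ((List.range n).map w).prod
  have hU0 : U 0 = 1 := rfl
  have hU1 : ∀ n, U (n + 1) = U n * w n := fun n => List.prod_range_succ _ _
  have hUu : ∀ n, U n ∈ unitary A := fun n => by
    induction n with
    | zero => rw [hU0]; exact one_mem _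
    | succ n ih => rw [hU1]; exact mul_mem ih (hw n)
  have hUq : ∀ n k, n ≤ k → Commute (q k) (U n) := fun n k hk => by
    induction n with
    | zero => rw [hU0]; exact Commute.one_right _
    | succ n ih =>
      rw [hU1]
      exact (ih (by omega)).mul_right (hwc n _ (hpq n k (by omega)).symm (hqq k n (by omega)))
  have hUp : ∀ n k, k < n → U n * p k = q k * U n := fun n k hk => by
    induction n with
    | zero => omega
    | succ n ih =>
      rw [hU1]
      rcases Nat.lt_succ_iff_lt_or_eq.mp hk with h | rfl
      · rw [mul_assoc, ← (hwc n (p k) (hpp k n (by omega)) (hpq k n (by omega))).eq, ← mul_assoc,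
          ih h, mul_assoc]
      · rw [mul_assoc, hwp, ← mul_assoc, ← (hUq k k le_rfl).eq, mul_assoc]
  have hcauchy : CauchySeq U := by
    refine cauchySeq_of_summable_dist (Summable.of_norm_bounded_eventually_nat
      (hsum.mul_left 18) ?_)
    have hev : ∀ᶠ k in Filter.atTop, √(1 - c k ^ 2) < 1 / 2 :=
      hsum.tendsto_atTop_zero.eventually_lt_const (by norm_num)
    filter_upwards [hev] with k hk
    have hck : 1 / 2 ≤ c k := by
      have h1 : √(1 - c k ^ 2) ^ 2 = 1 - c k ^ 2 :=
        Real.sq_sqrt (by nlinarith [hc0 k, hc1 k])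
      nlinarith [hc0 k, Real.sqrt_nonneg (1 - c k ^ 2)]
    have e : U (k + 1) - U k = U k * (w k - 1) := by rw [hU1, mul_sub, mul_one]
    rw [Real.norm_of_nonneg dist_nonneg, dist_comm, dist_eq_norm, Nat.succ_eq_add_one, e,
      CStarRing.norm_mem_unitary_mul _ (hUu k)]
    exact hwn k hck
  obtain ⟨u, hu⟩ := cauchySeq_tendsto_of_complete hcauchy
  refine ⟨u, isClosed_unitary.mem_of_tendsto hu (Filter.Eventually.of_forall hUu), fun k => ?_⟩
  refine tendsto_nhds_unique (hu.mul_const (p k)) ((hu.const_mul (q k)).congr' ?_)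
  filter_upwards [Filter.eventually_gt_atTop k] with n hn
  exact (hUp n k hn).symm

end Rotation


/-! ### Square-summable angle differences give equivalent product states -/

section Factors

variable {A : Type*} [CStarAlgebra A] {f : ℕ → Matrix (Fin 2) (Fin 2) ℂ →⋆ₐ[ℂ] A}

/-- Cutting `ℕ` into the intervals `[N k, N (k + 1))` such that the sum over the `k`-th of them
is at most `(1 / 4) ^ (k - 1)` for `k ≥ 1`. -/
theorem exists_blocks_sum_le {d : ℕ → ℝ} (hd : Summable d) (h0 : ∀ i, 0 ≤ d i) :
    ∃ N : ℕ → ℕ, N 0 = 0 ∧ Monotone N ∧ (∀ k, k ≤ N (k + 1)) ∧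
      ∀ k n, ∑ i ∈ Finset.range n, d (N (k + 1) + i) ≤ (1 / 4) ^ k := by
  obtain ⟨φ, hφ, h⟩ := Filter.extraction_forall_of_eventually
    (P := fun k n => ∑' i, d (i + n) < (1 / 4 : ℝ) ^ k) fun k =>
      (tendsto_sum_nat_add d).eventually_lt_const (by positivity)
  refine ⟨fun k => Nat.casesOn (motive := fun _ => ℕ) k 0 φ, rfl, monotone_nat_of_le_succ fun k => ?_,
    fun k => hφ.id_le k, fun k n => ?_⟩
  · cases k with
    | zero => exact Nat.zero_le _
    | succ k => exact hφ.monotone (Nat.le_succ k)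
  · refine le_trans ?_ (h k).le
    simp only [add_comm (φ k)]
    exact ((summable_nat_add_iff (φ k)).mpr hd).sum_le_tsum _ fun i _ => h0 _

theorem one_sub_sum_le_prod_cos_sq (x : ℕ → ℝ) (n : ℕ) :
    1 - ∑ i ∈ Finset.range n, (2 * x i) ^ 2 ≤ (∏ i ∈ Finset.range n, Real.cos (x i)) ^ 2 := by
  induction n with
  | zero => simp
  | succ n ih =>
    rw [Finset.sum_range_succ, Finset.prod_range_succ, mul_pow]
    have h1 : (∏ i ∈ Finset.range n, Real.cos (x i)) ^ 2 ≤ 1 := by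
      rw [← Finset.prod_pow]
      exact Finset.prod_le_one (fun _ _ => sq_nonneg _) fun i _ => Real.cos_sq_le_one _
    have h2 : Real.sin (x n) ^ 2 ≤ x n ^ 2 := sq_le_sq.mpr Real.abs_sin_le_abs
    have h3 := Real.sin_sq_add_cos_sq (x n)
    have h4 := sq_nonneg (∏ i ∈ Finset.range n, Real.cos (x i))
    nlinarith [mul_nonneg h4 (sq_nonneg (Real.sin (x n))),
      mul_nonneg (sub_nonneg.mpr h1) (sq_nonneg (Real.sin (x n)))]

/-- The sequence of factors is cut into blocks in which the two product vectors are close. The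
rotations in the planes of these pairs of vectors are then so close to `1` that their product
converges in norm, which need not hold for the rotations in the single factors. -/
theorem exists_unitary_conj_of_summable_sq (hf : ∀ i j, i ≠ j → ∀ M N, Commute (f i M) (f j N))
    (hd : Dense (StarAlgebra.adjoin ℂ (⋃ n, Set.range (f n)) : Set A)) {φ ψ : WeakDual ℂ A}
    (hφ : φ ∈ stateSet A) (hψ : ψ ∈ stateSet A) {α β : ℕ → ℝ}
    (h1 : ∀ i, φ (f i (angleProj (α i))) = 1) (h2 : ∀ i, ψ (f i (angleProj (β i))) = 1)
    (hlt : ∀ i, |α i - β i| < Real.pi) (hs : Summable fun i => (α i - β i) ^ 2) :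
    ∃ u ∈ unitary A, ∀ a, φ a = ψ (u * a * star u) := by
  obtain ⟨N, hN0, hNm, hNk, hN⟩ := exists_blocks_sum_le hs fun i => sq_nonneg _
  let g : ℕ → ℕ → Matrix (Fin 2) (Fin 2) ℂ →⋆ₐ[ℂ] A := fun k i => f (N k + i)
  have hg : ∀ k i j, i ≠ j → ∀ M N, Commute (g k i M) (g k j N) := fun k i j hij =>
    hf _ _ (by omega)
  let l : ℕ → ℕ := fun k => N (k + 1) - N k
  let P : (ℕ → ℝ) → ℕ → A := fun θ k =>
    tensorProd (g k) (fun i => angleProj (θ (N k + i))) (l k)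
  have hP : ∀ θ k, IsStarProjection (P θ k) := fun θ k =>
    isStarProjection_tensorProd (hg k) (fun i => θ (N k + i)) (l k)
  have hcomm : ∀ θ τ j k, j ≠ k → Commute (P θ j) (P τ k) := fun θ τ j k hjk => by
    refine commute_tensorProd fun i hi => (commute_tensorProd fun i' hi' => hf _ _ ?_ _ _).symm
    have hi : i < N (k + 1) - N k := hi
    have hi' : i' < N (j + 1) - N j := hi'
    rcases lt_or_gt_of_ne hjk with h | h
    · have := hNm (Nat.succ_le_of_lt h)
      simp only [Nat.succ_eq_add_one] at this
      omega
    · have := hNm (Nat.succ_le_of_lt h)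
      simp only [Nat.succ_eq_add_one] at this
      omega
  let c : ℕ → ℝ := fun k =>
    ∏ i ∈ Finset.range (l k), Real.cos ((α (N k + i) - β (N k + i)) / 2)
  have hcos : ∀ i, 0 < Real.cos ((α i - β i) / 2) := fun i => by
    have := abs_lt.mp (hlt i)
    exact Real.cos_pos_of_mem_Ioo ⟨by linarith, by linarith⟩
  have hpqp : ∀ k, P α k * P β k * P α k = ((c k ^ 2 : ℝ) : ℂ) • P α k := fun k =>
    tensorProd_angleProj_mul_mul (hg k) (fun i => α (N k + i)) (fun i => β (N k + i)) (l k)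
  have hqpq : ∀ k, P β k * P α k * P β k = ((c k ^ 2 : ℝ) : ℂ) • P β k := fun k => by
    have hc : c k = ∏ i ∈ Finset.range (l k), Real.cos ((β (N k + i) - α (N k + i)) / 2) :=
      Finset.prod_congr rfl fun i _ => by rw [← Real.cos_neg, ← neg_div, neg_sub]
    rw [hc]
    exact tensorProd_angleProj_mul_mul (hg k) (fun i => β (N k + i)) (fun i => α (N k + i)) (l k)
  have hsum : Summable fun k => √(1 - c k ^ 2) := by
    rw [← summable_nat_add_iff 1]
    refine Summable.of_nonneg_of_le (fun _ => Real.sqrt_nonneg _) (fun k => ?_)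
      summable_geometric_two
    have hb := one_sub_sum_le_prod_cos_sq
      (fun i => (α (N (k + 1) + i) - β (N (k + 1) + i)) / 2) (l (k + 1))
    have hb' := hN k (l (k + 1))
    simp only [mul_div_cancel₀ _ (two_ne_zero' ℝ)] at hb
    rw [Real.sqrt_le_left (by positivity), ← pow_mul, mul_comm k 2, pow_mul]
    norm_num only at hb' ⊢
    simp only [c]
    linarith
  obtain ⟨u, hu, hup⟩ := exists_unitary_rotation_seq (hP α) (hP β)
    (fun k => Finset.prod_pos fun i _ => hcos _)
    (fun k => Finset.prod_le_one (fun i _ => (hcos _).le) fun i _ => Real.cos_le_one _)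
    hpqp hqpq (hcomm α α) (hcomm β β) (hcomm α β) hsum
  have hu' : star u ∈ unitary A := Unitary.star_mem hu
  have hχ : compress ψ (star u) ∈ stateSet A :=
    compress_mem_stateSet hψ (by rw [Unitary.star_mul_self_of_mem hu', hψ.2])
  have hχP : ∀ k, compress ψ (star u) (P α k) = 1 := fun k => by
    rw [compress_apply, star_star, hup, mul_assoc, Unitary.mul_star_self_of_mem hu, mul_one,
      apply_tensorProd (hg k) hψ (θ := fun i => β (N k + i)) fun i => h2 _]
    simp [vectorState_angleProj]
  have hχ1 : ∀ i, compress ψ (star u) (f i (angleProj (α i))) = 1 := fun i => by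
    obtain ⟨k, hk, hk'⟩ : ∃ k, N k ≤ i ∧ i < N (k + 1) := by
      have : ∀ K, i < N K → ∃ k, N k ≤ i ∧ i < N (k + 1) := fun K => by
        induction K with
        | zero => rw [hN0]; omega
        | succ K ih =>
          intro h
          by_cases h' : i < N K
          · exact ih h'
          · exact ⟨K, by omega, h⟩
      exact this (i + 2) (hNk (i + 1))
    have h := tensorProd_angleProj_mul (hg k) (fun j => α (N k + j)) (i := i - N k) (n := l k)
      (by simp only [l]; omega)
    have e : N k + (i - N k) = i := by omega
    simp only [g, e] at h
    exact apply_eq_one_of_mul_eq hχ (hP α k) (hχP k) h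
  refine ⟨u, hu, fun a => ?_⟩
  rw [eq_of_apply_angleProj hf hd hφ hχ h1 hχ1, compress_apply, star_star]

/-- The product states with angles in `(-π / 2, π / 2)`, over any dense family of commuting copies
of the `2 × 2` matrices that carries the product state with angles `0`. -/
theorem exists_productStates (hf : ∀ i j, i ≠ j → ∀ M N, Commute (f i M) (f j N))
    (hd : Dense (StarAlgebra.adjoin ℂ (⋃ n, Set.range (f n)) : Set A)) {φ : WeakDual ℂ A}
    (hφ : φ ∈ stateSet A) (h0 : ∀ i, φ (f i (angleProj 0)) = 1) :
    ∃ Φ : (ℕ → Set.Ioo (-(Real.pi / 2)) (Real.pi / 2)) → pureStates A,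
      Continuous Φ ∧
      (∀ α n a, (Φ α : WeakDual ℂ A) (tensorProd f a n) =
        ∏ i ∈ Finset.range n, vectorState (angleVector (α i)) (a i)) ∧
      ∀ α β, (Summable fun n => ((α n : ℝ) - (β n : ℝ)) ^ 2) ↔ PureStateEquiv (Φ α) (Φ β) := by
  have hex : ∀ α : ℕ → Set.Ioo (-(Real.pi / 2)) (Real.pi / 2),
      ∃ ψ ∈ stateSet A, ∀ i, ψ (f i (angleProj (α i))) = 1 := fun α =>
    exists_mem_stateSet_apply_angleProj hf hφ h0
      fun i => (Real.cos_pos_of_mem_Ioo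
        ⟨by linarith [(α i).2.1, Real.pi_pos], by linarith [(α i).2.2, Real.pi_pos]⟩).ne'
  choose Ψ hΨ hΨ1 using hex
  have hlt : ∀ (α β : ℕ → Set.Ioo (-(Real.pi / 2)) (Real.pi / 2)) (i : ℕ),
      |(α i : ℝ) - β i| < Real.pi := fun α β i => by
    rw [abs_lt]
    constructor <;> linarith [(α i).2.1, (α i).2.2, (β i).2.1, (β i).2.2]
  have hangle : ∀ i, Continuous fun α : ℕ → Set.Ioo (-(Real.pi / 2)) (Real.pi / 2) =>
      (α i : ℝ) := fun i => by fun_prop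
  have hcont : Continuous Ψ := continuous_of_apply_angleProj hf hd hangle hΨ hΨ1
  refine ⟨fun α => ⟨Ψ α, mem_pureStates_of_apply_angleProj hf hd (hΨ α) (hΨ1 α)⟩, ?_,
    fun α n a => apply_tensorProd hf (hΨ α) (hΨ1 α) a n, fun α β => ⟨fun hs => ?_, ?_⟩⟩
  · exact continuous_induced_rng.mpr hcont
  · exact exists_unitary_conj_of_summable_sq hf hd (hΨ α) (hΨ β) (hΨ1 α) (hΨ1 β) (hlt α β) hs
  · rintro ⟨u, hu, h⟩
    exact summable_sq_of_unitary_conj hf hd (hΨ α) (hΨ β) (hΨ1 α) (hΨ1 β) (hlt α β) hu h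

end Factors


/-! ### The CAR algebra -/

theorem commute_carFactor (i j : ℕ) (h : i ≠ j) (M N : Matrix (Fin 2) (Fin 2) ℂ) :
    Commute (carFactor i M) (carFactor j N) :=
  Subtype.ext (carHom_commute h M N).eq

theorem dense_adjoin_carFactor :
    Dense (StarAlgebra.adjoin ℂ (⋃ n, Set.range (carFactor n)) : Set CARAlgebra) := by
  have hle : StarAlgebra.adjoin ℂ (⋃ n, Set.range (carHom n)) ≤
      (StarAlgebra.adjoin ℂ (⋃ n, Set.range (carFactor n))).map carSubalgebra.subtype := by
    refine StarAlgebra.adjoin_le fun x hx => ?_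
    obtain ⟨n, M, rfl⟩ := Set.mem_iUnion.mp hx
    exact ⟨carFactor n M,
      StarAlgebra.subset_adjoin ℂ _ (Set.mem_iUnion.mpr ⟨n, M, rfl⟩), rfl⟩
  rw [Subtype.dense_iff]
  exact fun x hx => closure_mono hle hx

/-- The unit vector `e_0 ⊗ e_0 ⊗ ⋯`. -/
def carVacuum : CARSpace := lp.single 2 0 1

/-- The vector state of the CAR algebra at `e_0 ⊗ e_0 ⊗ ⋯`. -/
def carVacuumState : WeakDual ℂ CARAlgebra :=
  StrongDual.toWeakDual ((innerSL ℂ carVacuum).comp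
    ((ContinuousLinearMap.apply ℂ CARSpace carVacuum).comp carSubalgebra.toSubmodule.subtypeL))

theorem carVacuumState_apply (a : CARAlgebra) :
    carVacuumState a = inner ℂ carVacuum ((a : CARSpace →L[ℂ] CARSpace) carVacuum) := rfl

theorem inner_carVacuum_left (g : CARSpace) : inner ℂ carVacuum g = g 0 := by
  rw [carVacuum, lp.inner_single_left]
  simp

theorem carVacuum_apply_zero : carVacuum 0 = 1 := by
  simp [carVacuum]

theorem carVacuumState_mem : carVacuumState ∈ stateSet CARAlgebra := by
  constructor
  · intro a
    rw [carVacuumState_apply]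
    change 0 ≤ inner ℂ carVacuum ((star (a : CARSpace →L[ℂ] CARSpace) *
      (a : CARSpace →L[ℂ] CARSpace)) carVacuum)
    rw [ContinuousLinearMap.star_eq_adjoint, mul_apply_eq_comp,
      ContinuousLinearMap.adjoint_inner_right]
    exact RCLike.nonneg_iff.mpr ⟨inner_self_nonneg, inner_self_im _⟩
  · rw [carVacuumState_apply]
    change inner ℂ carVacuum carVacuum = 1
    rw [inner_carVacuum_left, carVacuum_apply_zero]

theorem carVacuumState_angleProj (i : ℕ) : carVacuumState (carFactor i (angleProj 0)) = 1 := by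
  rw [carVacuumState_apply, inner_carVacuum_left]
  change carAct i (angleProj 0) carVacuum 0 = 1
  rw [carAct_apply', carVacuum_apply_zero]
  simp [angleProj, angleVector, Matrix.vecMulVec_apply]

end

theorem theorem5 :
    ∃ Φ : (ℕ → Set.Ioo (-(Real.pi / 2)) (Real.pi / 2)) → pureStates CARAlgebra,
      Continuous Φ ∧
      (∀ α, IsProductState (Φ α : WeakDual ℂ CARAlgebra)
        (fun n => ![(Real.cos ((α n : ℝ) / 2) : ℂ), (Real.sin ((α n : ℝ) / 2) : ℂ)])) ∧
      ∀ α β, (Summable fun n => ((α n : ℝ) - (β n : ℝ)) ^ 2) ↔ PureStateEquiv (Φ α) (Φ β) := by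
  obtain ⟨Φ, hc, hp, he⟩ := exists_productStates commute_carFactor dense_adjoin_carFactor
    carVacuumState_mem carVacuumState_angleProj
  exact ⟨Φ, hc, fun α n a => hp α n a, he⟩
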